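/- Let $\mathbb{K}$ be a field, $\Gamma$ a divisible totally ordered abelian group, and $\nu_0:\mathbb{K}\to\Gamma\cup\{\infty\}$ a valuation. Consider the valuations $\mu:\mathbb{K}[x]\to\Gamma\cup\{\infty\}$ with $\mu|_{\mathbb{K}}=\nu_0$, ordered by $\mu\le\eta$ iff $\mu(f)\le\eta(f)$ for all $f\in\mathbb{K}[x]$; such a $\mu$ may take the value $\infty$ at nonzero polynomials, and it is called Krull if it does not. We say that $\mu$ is *value-transcendental* if it is not Krull or the quotient $\mu(\mathbb{K}[x])/\nu_0\mathbb{K}$ of value groups is not a torsion group; *residue-transcendental* if it is Krull and, for its extension to $\mathbb{K}(x)$, the residue field extension $\mathbb{K}(x)\mu\mid\mathbb{K}\nu_0$ is transcendental; *valuation-algebraic* if it is neither. Let $\nu$ be such a valuation on $\mathbb{K}[x]$. Choose an extension $\overline{\nu}$ of $\nu$ to $\overline{\mathbb{K}}[x]$ with values in $\Gamma\cup\{\infty\}$, where $\overline{\mathbb{K}}$ is an algebraic closure of $\mathbb{K}$. For a nonzero $f\in\mathbb{K}[x]$ put $\delta(f)=\max\{\overline{\nu}(x-a)\mid a\in\overline{\mathbb{K}},\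 f(a)=0\}$ if $\deg f>0$ and $\delta(f)=-\infty$ if $\deg f=0$ (this does not depend on the choice of $\overline{\nu}$). A non-constant monic polynomial $Q\in\mathbb{K}[x]$ is a *key polynomial* for $\nu$ if $\deg f\ge\deg Q$ for every nonzero $f\in\mathbb{K}[x]$ with $\delta(f)\ge\delta(Q)$. The *truncation* of $\nu$ at a non-constant $Q$ is the map $\nu_Q(f)=\min_{0\le i\le s}\nu(f_iQ^i)$, where $f=f_0+f_1Q+\dots+f_sQ^s$ with $\deg f_i<\deg Q$ for all $i$. Suppose that $\nu$ is valuation-algebraic. Then there is a set $\mathbf{Q}$ of key polynomials for $\nu$ such that each truncation $\nu_Q$, $Q\in\mathbf{Q}$, is a valuation on $\mathbb{K}[x]$ extending $\nu_0$, and the set $\mathfrak{v}=\{\nu_Q\}_{Q\in\mathbf{Q}}$ has the following properties: 1. $\mathfrak{v}$ is totally ordered and has no maximal element; 2. every $f\in\mathbb{K}[x]$ is $\mathfrak{v}$-stable, that is, there is $Q_f\in\mathbf{Q}$ such that $\nu_Q(f)=\nu_{Q_f}(f)$ for every $Q\in\mathbf{Q}$ with $\nu_Q\ge\nu_{Q_f}$;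 3. $\nu=\sup_{Q\in\mathbf{Q}}\nu_Q$, that is, $\nu(f)=\nu_{Q_f}(f)$ for every $f\in\mathbb{K}[x]$ and every $Q_f$ as in 2; in particular $\nu$ is the least upper bound of $\mathfrak{v}$ among the valuations on $\mathbb{K}[x]$ extending $\nu_0$ with values in $\Gamma\cup\{\infty\}$; 4. each $\nu_Q$, $Q\in\mathbf{Q}$, is residue-transcendental. -/

import Mathlib

open Polynomial

noncomputable section

namespace KeyPoly

/-- A valuation on a commutative ring is *Krull* if its support is `{0}`. -/
def IsKrull {R Γ : Type*} [CommRing R] [AddCommGroup Γ] [LinearOrder Γ] [IsOrderedAddMonoid Γ]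
    (ν : AddValuation R (WithTop Γ)) : Prop :=
  ∀ f : R, ν f = ⊤ → f = 0

/-- The value group of a valuation: the subgroup of `Γ` generated by the finite values. -/
def valueGroup {R Γ : Type*} [CommRing R] [AddCommGroup Γ] [LinearOrder Γ] [IsOrderedAddMonoid Γ]
    (ν : AddValuation R (WithTop Γ)) : AddSubgroup Γ :=
  AddSubgroup.closure {γ : Γ | ∃ f : R, ν f = (γ : WithTop Γ)}

variable {K Γ : Type*} [Field K] [AddCommGroup Γ] [LinearOrder Γ] [IsOrderedAddMonoid Γ]

/-- The valuations on `K[x]` with values in `Γ ∪ {∞}` that extend the valuation `ν₀` of `K`. -/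
def ExtVal (ν₀ : AddValuation K (WithTop Γ)) : Type _ :=
  {ν : AddValuation K[X] (WithTop Γ) // ∀ a : K, ν (C a) = ν₀ a}

/-- `μ ≤ η` if and only if `μ f ≤ η f` for every polynomial `f`. -/
instance (ν₀ : AddValuation K (WithTop Γ)) : PartialOrder (ExtVal ν₀) :=
  PartialOrder.lift (fun (ν : ExtVal ν₀) (f : K[X]) => ν.1 f)
    (fun _ _ h => Subtype.ext (DFunLike.coe_injective h))

/-! ### Key polynomials and truncations -/

/-- `δ(f) = max {ν̄(x - a) | f(a) = 0}` for a nonzero polynomial `f` over the algebraic closure;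
it is `⊥ = -∞` if `f` is a nonzero constant. -/
def delta (νbar : AddValuation (AlgebraicClosure K)[X] (WithTop Γ))
    (f : (AlgebraicClosure K)[X]) : WithBot (WithTop Γ) :=
  open Classical in
  f.roots.toFinset.sup (fun a => ((νbar (X - C a) : WithTop Γ) : WithBot (WithTop Γ)))

/-- `ν̄` is an extension of `ν` from `K[x]` to polynomials over the algebraic closure. -/
def ExtendsToClosure (νbar : AddValuation (AlgebraicClosure K)[X] (WithTop Γ))
    (ν : AddValuation K[X] (WithTop Γ)) : Prop :=
  ∀ f : K[X], νbar (f.map (algebraMap K (AlgebraicClosure K))) = ν f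

/-- `Q` is a key polynomial for `ν`: it is monic, not constant, and every nonzero polynomial `f`
over `K` with `δ(f) ≥ δ(Q)` has `deg f ≥ deg Q`. Here `δ` is computed with an extension `ν̄` of `ν`
to the polynomials over the algebraic closure; the values `δ(f)`, for `f` over `K`, do not depend
on the extension. -/
def IsKeyPolynomial (ν : AddValuation K[X] (WithTop Γ)) (Q : K[X]) : Prop :=
  Q.Monic ∧ 0 < Q.natDegree ∧
    ∃ νbar : AddValuation (AlgebraicClosure K)[X] (WithTop Γ), ExtendsToClosure νbar ν ∧
      ∀ f : K[X], f ≠ 0 →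
        delta νbar (Q.map (algebraMap K (AlgebraicClosure K))) ≤
          delta νbar (f.map (algebraMap K (AlgebraicClosure K))) →
        Q.natDegree ≤ f.natDegree

/-- The `i`-th coefficient of the `q`-expansion `f = f₀ + f₁ q + ⋯ + fₛ qˢ` (with
`deg fᵢ < deg q`), for a non-constant `q`: divide `i` times by `q`, then take the remainder. -/
def expansionCoeff (q f : K[X]) (i : ℕ) : K[X] :=
  ((fun g : K[X] => g / q)^[i] f) % q

/-- The truncation `ν_q(f) = min ν(fᵢ qⁱ)` of `ν` at a non-constant `q`. The coefficients `fᵢ` with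
`i > deg f` vanish, and vanishing coefficients contribute the value `∞`. -/
def truncation (ν : AddValuation K[X] (WithTop Γ)) (q f : K[X]) : WithTop Γ :=
  (Finset.range (f.natDegree + 1)).inf (fun i => ν (expansionCoeff q f i * q ^ i))

/-! ### Valuation-algebraic and residue-transcendental valuations -/

theorem IsKrull.le_primeCompl {ν : AddValuation K[X] (WithTop Γ)} (h : IsKrull ν) :
    nonZeroDivisors K[X] ≤ (AddValuation.toValuation ν).supp.primeCompl := by
  intro f hf hsupp
  exact nonZeroDivisors.ne_zero hf (h f hsupp)

/-- The unique extension of a Krull valuation on `K[x]` to the field `K(x)`, written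
multiplicatively. -/
def fracValuation (ν : AddValuation K[X] (WithTop Γ)) (h : IsKrull ν) :
    Valuation (RatFunc K) (Multiplicative (WithTop Γ)ᵒᵈ) :=
  (AddValuation.toValuation ν).extendToLocalization h.le_primeCompl (RatFunc K)

theorem fracValuation_hasExtension {ν₀ : AddValuation K (WithTop Γ)} (ν : ExtVal ν₀)
    (h : IsKrull ν.1) :
    (AddValuation.toValuation ν₀).HasExtension (fracValuation ν.1 h) := by
  constructor
  have : AddValuation.toValuation ν₀ =
      (fracValuation ν.1 h).comap (algebraMap K (RatFunc K)) := by
    ext a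
    rw [Valuation.comap_apply, IsScalarTower.algebraMap_apply K K[X] (RatFunc K), fracValuation,
      Valuation.extendToLocalization_apply_map_apply]
    exact (ν.2 a).symm
  rw [← this]
  exact Valuation.IsEquiv.refl

/-- `ν` is residue-transcendental: it is Krull and the extension of residue fields
`K(x)ν | Kν₀` is transcendental. -/
def IsResidueTranscendental {ν₀ : AddValuation K (WithTop Γ)} (ν : ExtVal ν₀) : Prop :=
  ∃ h : IsKrull ν.1,
    letI := fracValuation_hasExtension ν h
    Algebra.Transcendental
      (IsLocalRing.ResidueField (AddValuation.toValuation ν₀).valuationSubring)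
      (IsLocalRing.ResidueField (fracValuation ν.1 h).valuationSubring)

/-- `ν` is value-transcendental: it is not Krull or the quotient of its value group by that of
`ν₀` is not a torsion group. -/
def IsValueTranscendental {ν₀ : AddValuation K (WithTop Γ)} (ν : ExtVal ν₀) : Prop :=
  ¬ IsKrull ν.1 ∨
    ¬ IsAddTorsion
      (valueGroup ν.1 ⧸ (valueGroup ν₀).addSubgroupOf (valueGroup ν.1))

/-- `ν` is valuation-algebraic: it is neither value-transcendental nor residue-transcendental. -/
def IsValuationAlgebraic {ν₀ : AddValuation K (WithTop Γ)} (ν : ExtVal ν₀) : Prop :=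
  ¬ (IsValueTranscendental ν ∨ IsResidueTranscendental ν)

/-! ### Stability and suprema of totally ordered sets of valuations -/

/-- From the element `μ` of `S` on, all members of `S` take the same value at `f`. -/
def StableFrom {ν₀ : AddValuation K (WithTop Γ)} (S : Set (ExtVal ν₀)) (f : K[X])
    (μ : ExtVal ν₀) : Prop :=
  μ ∈ S ∧ ∀ η ∈ S, μ ≤ η → η.1 f = μ.1 f

/-- `f` is `S`-stable. -/
def IsStable {ν₀ : AddValuation K (WithTop Γ)} (S : Set (ExtVal ν₀)) (f : K[X]) : Prop :=
  ∃ μ : ExtVal ν₀, StableFrom S f μ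

/-- `ν` is the supremum of a totally ordered set `S` for which all polynomials are stable: `ν f`
is the stable value of `f`, for every `f`. -/
def IsStableSup {ν₀ : AddValuation K (WithTop Γ)} (S : Set (ExtVal ν₀)) (ν : ExtVal ν₀) : Prop :=
  ∀ f : K[X], ∀ μ : ExtVal ν₀, StableFrom S f μ → ν.1 f = μ.1 f

end KeyPoly

end

open KeyPoly

noncomputable section

namespace KeyPoly

/-! ### Sums of elements with distinct values -/

/-! Extend `ν` to `νbar` over the algebraic closure; divisibility of `Γ` keeps the values in `Γ`. A
centre `a` with `γ = νbar (X - C a)` defines a Gauss valuation with value `min γ (νbar (X - C b))`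
at each `X - C b`. It lies below `νbar`, grows with `γ`, and agrees with `νbar` on every nonzero
polynomial whose roots `b` all satisfy `νbar (X - C b) ≤ γ`.

If some `νbar (X - C a)` were maximal, the Gauss valuation at `a` would restrict to `ν` and be
residue-transcendental. So these values have no maximum (`exists_linear_lt`). A polynomial of least
degree with `δ` above a given bound is, once monic, a key polynomial (`exists_isKeyFor`), so the
`δ(Q)` are cofinal. Order, stability and supremum follow, provided the truncation at `Q` is the
restricted Gauss valuation centred at a root of `Q` that realises `δ(Q)`.

That identification (`IsCenter.restrictGauss_eq_truncation`) and residue transcendence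
(`isResidueTranscendental_of_lex`) share one device: give `X - C a` the value `(γ, -1)` in `Γ ×ₗ ℤ`.
The second component separates the powers of `Q`, so a sum of terms `fᵢ Qⁱ` takes exactly the
minimal value; projecting to `Γ` recovers the Gauss valuation. -/

theorem map_sum_eq_inf {R Γ₀ ι : Type*} [Ring R] [LinearOrderedAddCommMonoidWithTop Γ₀]
    (v : AddValuation R Γ₀) (s : Finset ι) (h : ι → R)
    (hd : ∀ i ∈ s, ∀ j ∈ s, i ≠ j → v (h i) = v (h j) → v (h i) = ⊤) :
    v (∑ i ∈ s, h i) = s.inf fun i => v (h i) := by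
  classical
  induction s using Finset.induction_on with
  | empty => simp
  | insert a s ha ih =>
    rw [Finset.sum_insert ha, Finset.inf_insert]
    have ih' := ih fun i hi j hj =>
      hd i (Finset.mem_insert_of_mem hi) j (Finset.mem_insert_of_mem hj)
    by_cases hne : v (h a) = v (∑ i ∈ s, h i)
    -- The value of the partial sum is attained by one of its terms, so a tie with the new term is a
    -- tie between two terms and forces the value `⊤`.
    · have htop : v (h a) = ⊤ := by
        rcases s.eq_empty_or_nonempty with rfl | hs
        · simpa using hne
        · obtain ⟨j, hj, hj'⟩ := s.exists_mem_eq_inf hs fun i => v (h i)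
          refine hd a (Finset.mem_insert_self _ _) j (Finset.mem_insert_of_mem hj) ?_ ?_
          · rintro rfl; exact ha hj
          · rw [hne, ih', hj']
      rw [← ih', ← hne, htop, inf_idem, eq_top_iff]
      exact v.map_le_add htop.ge (hne ▸ htop).ge
    · rw [← ih']
      exact v.map_add_of_distinct_val hne

/-! ### Gauss valuations -/

section Gauss

variable {L G : Type*} [Field L] [AddCommGroup G] [LinearOrder G] [IsOrderedAddMonoid G]

/-- The value `min (v cᵢ + i γ)` of a polynomial `∑ cᵢ xⁱ`. -/
def gaussFun (v : AddValuation L (WithTop G)) (γ : G) (f : L[X]) : WithTop G :=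
  f.support.inf fun i => v (f.coeff i) + ((i • γ : G) : WithTop G)

theorem le_gaussFun_iff {v : AddValuation L (WithTop G)} {γ : G} {f : L[X]} {b : WithTop G} :
    b ≤ gaussFun v γ f ↔ ∀ i, b ≤ v (f.coeff i) + ((i • γ : G) : WithTop G) := by
  rw [gaussFun, Finset.le_inf_iff]
  refine ⟨fun h i => ?_, fun h i _ => h i⟩
  by_cases hi : f.coeff i = 0
  · simp [hi]
  · exact h i (mem_support_iff.2 hi)

theorem gaussFun_le (v : AddValuation L (WithTop G)) (γ : G) (f : L[X]) (i : ℕ) :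
    gaussFun v γ f ≤ v (f.coeff i) + ((i • γ : G) : WithTop G) :=
  le_gaussFun_iff.1 le_rfl i

theorem exists_gaussFun_eq (v : AddValuation L (WithTop G)) (γ : G) {f : L[X]} (hf : f ≠ 0) :
    gaussFun v γ f ≠ ⊤ ∧
    ∃ i, gaussFun v γ f = v (f.coeff i) + ((i • γ : G) : WithTop G) ∧
      ∀ j < i, gaussFun v γ f < v (f.coeff j) + ((j • γ : G) : WithTop G) := by
  classical
  have hs : f.support.Nonempty := nonempty_support_iff.2 hf
  obtain ⟨i, hi, hi'⟩ := f.support.exists_mem_eq_inf hs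
    fun i => v (f.coeff i) + ((i • γ : G) : WithTop G)
  have hex : ∃ i, gaussFun v γ f = v (f.coeff i) + ((i • γ : G) : WithTop G) := ⟨i, hi'⟩
  refine ⟨?_, Nat.find hex, Nat.find_spec hex, fun j hj => ?_⟩
  · change gaussFun v γ f = _ at hi'
    rw [hi', WithTop.add_ne_top]
    exact ⟨(AddValuation.ne_top_iff v).2 (mem_support_iff.1 hi), WithTop.coe_ne_top⟩
  · exact lt_of_le_of_ne (gaussFun_le v γ f j) (Nat.find_min hex hj)

/-- Take the least indices `i`, `j` at which `f` and `g` attain their minima. Any other pair of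
indices with sum `i + j` has first index below `i` or second below `j`, so `fᵢ gⱼ` alone has the
smallest value in that coefficient of the product. The other inequality holds term by term. -/
theorem gaussFun_mul (v : AddValuation L (WithTop G)) (γ : G) (f g : L[X]) :
    gaussFun v γ (f * g) = gaussFun v γ f + gaussFun v γ g := by
  by_cases hf : f = 0
  · simp [hf, gaussFun]
  by_cases hg : g = 0
  · simp [hg, gaussFun]
  have hval : ∀ x : ℕ × ℕ, v (f.coeff x.1 * g.coeff x.2) + (((x.1 + x.2) • γ : G) : WithTop G) =
      (v (f.coeff x.1) + ((x.1 • γ : G) : WithTop G)) +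
        (v (g.coeff x.2) + ((x.2 • γ : G) : WithTop G)) := by
    intro x
    rw [AddValuation.map_mul, add_smul, WithTop.coe_add, add_add_add_comm]
  have hsub : ∀ (b : WithTop G) (n : ℕ), (b + ((-(n • γ) : G) : WithTop G)) +
      ((n • γ : G) : WithTop G) = b := by
    intro b n
    rw [add_assoc, ← WithTop.coe_add, neg_add_cancel, WithTop.coe_zero, add_zero]
  have hsub' : ∀ (b : WithTop G) (n : ℕ), (b + ((n • γ : G) : WithTop G)) +
      ((-(n • γ) : G) : WithTop G) = b := by
    intro b n
    rw [add_assoc, ← WithTop.coe_add, add_neg_cancel, WithTop.coe_zero, add_zero]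
  apply le_antisymm
  · obtain ⟨hft, i, hi, hi'⟩ := exists_gaussFun_eq v γ hf
    obtain ⟨hgt, j, hj, hj'⟩ := exists_gaussFun_eq v γ hg
    refine (gaussFun_le v γ (f * g) (i + j)).trans_eq ?_
    have hmem : (i, j) ∈ Finset.HasAntidiagonal.antidiagonal (i + j) := by simp
    rw [coeff_mul, ← Finset.add_sum_erase _ _ hmem, AddValuation.map_add_eq_of_lt_left, hval (i, j),
      hi, hj]
    have htop : v (f.coeff i * g.coeff j) ≠ ⊤ := by
      intro h
      have := hval (i, j)
      rw [h, ← hi, ← hj, top_add] at this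
      exact (WithTop.add_ne_top.2 ⟨hft, hgt⟩) this.symm
    refine AddValuation.map_lt_sum v htop fun x hx => ?_
    obtain ⟨hne, hx⟩ := Finset.mem_erase.1 hx
    rw [Finset.HasAntidiagonal.mem_antidiagonal] at hx
    have key : v (f.coeff i * g.coeff j) + (((i + j) • γ : G) : WithTop G) <
        v (f.coeff x.1 * g.coeff x.2) + (((i + j) • γ : G) : WithTop G) := by
      rw [hval (i, j), ← hi, ← hj, ← hx, hval x]
      rcases lt_trichotomy x.1 i with h | h | h
      · exact WithTop.add_lt_add_of_lt_of_le hgt (hi' _ h) (gaussFun_le v γ g _)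
      · exact absurd (Prod.ext h (by omega)) hne
      · exact WithTop.add_lt_add_of_le_of_lt hft (gaussFun_le v γ f _) (hj' _ (by omega))
    exact lt_of_add_lt_add_right key
  · refine le_gaussFun_iff.2 fun n => ?_
    rw [coeff_mul, ← hsub (gaussFun v γ f + gaussFun v γ g) n]
    refine add_le_add_left (AddValuation.map_le_sum v fun x hx => ?_) _
    rw [Finset.HasAntidiagonal.mem_antidiagonal] at hx
    rw [← hsub' (v (f.coeff x.1 * g.coeff x.2)) n]
    refine add_le_add_left ?_ _
    rw [← hx, hval x]
    exact add_le_add (gaussFun_le v γ f _) (gaussFun_le v γ g _)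

/-- The Gauss valuation on `L[x]` that extends `v` and takes the value `γ` at `x`. -/
def gaussVal (v : AddValuation L (WithTop G)) (γ : G) : AddValuation L[X] (WithTop G) :=
  AddValuation.of (gaussFun v γ) (by simp [gaussFun])
    (by
      apply le_antisymm
      · simpa using gaussFun_le v γ 1 0
      · refine le_gaussFun_iff.2 fun i => ?_
        rcases i with _ | i <;> simp [coeff_one])
    (by
      intro f g
      refine le_gaussFun_iff.2 fun i => ?_
      rw [coeff_add]
      have h := AddValuation.map_add v (f.coeff i) (g.coeff i)
      refine le_trans ?_ (add_le_add_left h _)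
      rw [min_add]
      exact min_le_min (gaussFun_le v γ f i) (gaussFun_le v γ g i))
    (gaussFun_mul v γ)

theorem gaussVal_C (v : AddValuation L (WithTop G)) (γ : G) (c : L) :
    gaussVal v γ (C c) = v c := by
  apply le_antisymm
  · refine (gaussFun_le v γ (C c) 0).trans_eq ?_
    simp
  · refine le_gaussFun_iff.2 fun i => ?_
    rcases i with _ | i <;> simp [coeff_C]

theorem gaussVal_X_sub_C (v : AddValuation L (WithTop G)) (γ : G) (c : L) :
    gaussVal v γ (X - C c) = min (γ : WithTop G) (v c) := by
  apply le_antisymm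
  · refine le_min ?_ ?_
    · refine (gaussFun_le v γ (X - C c) 1).trans_eq ?_
      simp [-map_sub]
    · refine (gaussFun_le v γ (X - C c) 0).trans_eq ?_
      simp [-map_sub]
  · refine le_gaussFun_iff.2 fun i => ?_
    rcases i with _ | _ | i
    · simp
    · simp
    · simp [coeff_X]

/-- The Gauss valuation on `L[x]` with centre `a`: it takes the value `min (v cᵢ + i γ)` at
`∑ cᵢ (x - a)ⁱ`. -/
def gaussValAt (v : AddValuation L (WithTop G)) (a : L) (γ : G) : AddValuation L[X] (WithTop G) :=
  (gaussVal v γ).comap (compRingHom (X + C a))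

theorem gaussValAt_C (v : AddValuation L (WithTop G)) (a : L) (γ : G) (c : L) :
    gaussValAt v a γ (C c) = v c := by
  change gaussVal v γ ((C c).comp (X + C a)) = _
  rw [C_comp, gaussVal_C]

theorem gaussValAt_X_sub_C (v : AddValuation L (WithTop G)) (a : L) (γ : G) (b : L) :
    gaussValAt v a γ (X - C b) = min (γ : WithTop G) (v (b - a)) := by
  change gaussVal v γ ((X - C b).comp (X + C a)) = _
  rw [← gaussVal_X_sub_C]
  congr 1
  simp only [sub_comp, X_comp, C_comp, C_sub]
  ring

end Gauss

end KeyPoly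

end

noncomputable section

namespace KeyPoly

/-! ### Extending a valuation to an algebraic field extension -/

section Extension

variable {F L : Type*} [Field F] [Field L] [Algebra F L]

/-- Some valuation ring `B` of `L` dominates the image of the valuation ring of `v`. If `c` with `v
c > 1` landed in `B`, then `c⁻¹`, a nonunit below, would become a unit in `B`, against domination.
-/
theorem exists_valuationSubring_extension {Γ₀ : Type*} [LinearOrderedCommGroupWithZero Γ₀]
    (v : Valuation F Γ₀) : ∃ B : ValuationSubring L, v.HasExtension B.valuation := by
  obtain ⟨B, hB⟩ := (v.valuationSubring.toLocalSubring.map (algebraMap F L)).exists_le_valuationSubring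
  obtain ⟨hle, hloc⟩ := LocalSubring.le_def.1 hB
  refine ⟨B, Valuation.HasExtension.ofComapInteger ?_⟩
  ext c
  rw [Subring.mem_comap, Valuation.mem_integer_iff, Valuation.mem_integer_iff,
    B.valuation_le_one_iff]
  constructor
  · intro hc
    by_contra hlt
    rw [not_le] at hlt
    have hc0 : c ≠ 0 := by rintro rfl; simp at hlt
    have hinv : v c⁻¹ < 1 := by
      rw [map_inv₀]; exact inv_lt_one_of_one_lt₀ hlt
    have hmem : algebraMap F L c⁻¹ ∈
        (v.valuationSubring.toLocalSubring.map (algebraMap F L)).toSubring :=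
      ⟨c⁻¹, hinv.le, rfl⟩
    have hunit : IsUnit (⟨algebraMap F L c⁻¹, hmem⟩ :
        (v.valuationSubring.toLocalSubring.map (algebraMap F L)).toSubring) := by
      refine hloc.map_nonunit _ ?_
      refine IsUnit.of_mul_eq_one ⟨algebraMap F L c, hc⟩ (Subtype.ext ?_)
      change algebraMap F L c⁻¹ * algebraMap F L c = 1
      rw [← map_mul, inv_mul_cancel₀ hc0, map_one]
    obtain ⟨⟨y, x, hx, hxy⟩, hy⟩ := hunit.exists_right_inv
    have hy' : algebraMap F L c⁻¹ * y = 1 := congrArg Subtype.val hy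
    have hxy' : algebraMap F L x = y := hxy
    rw [← hxy', ← map_mul, map_eq_one_iff _ (algebraMap F L).injective] at hy'
    have hx1 : v x ≤ 1 := hx
    have : v c⁻¹ * v x = 1 := by rw [← map_mul, hy', map_one]
    exact absurd this (mul_lt_one_of_lt_of_le hinv hx1).ne
  · intro hc
    exact hle ⟨c, hc, rfl⟩

/-- In an algebraic relation for `y`, two nonzero terms must have equal values, or the sum could not
be zero. Comparing them gives a power of `y` with the value of a constant. -/
theorem exists_pow_val_eq [Algebra.IsAlgebraic F L] {G : Type*}
    [LinearOrderedAddCommGroupWithTop G] (u : AddValuation L G) {y : L} (hy : y ≠ 0) :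
    ∃ n : ℕ, 0 < n ∧ ∃ c : F, c ≠ 0 ∧ u (y ^ n) = u (algebraMap F L c) := by
  obtain ⟨p, hp0, hp⟩ := Algebra.IsAlgebraic.isAlgebraic (R := F) y
  by_contra hcon
  have hlt : ∀ i ∈ p.support, ∀ j ∈ p.support, i < j →
      u (algebraMap F L (p.coeff i) * y ^ i) ≠ u (algebraMap F L (p.coeff j) * y ^ j) := by
    intro i hi j hj hij h
    rw [mem_support_iff] at hi hj
    refine hcon ⟨j - i, by omega, p.coeff i / p.coeff j, div_ne_zero hi hj, ?_⟩
    have hj' : algebraMap F L (p.coeff j) ≠ 0 := by simpa using hj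
    have h1 : y ^ (j - i) = (algebraMap F L (p.coeff j) * y ^ i)⁻¹ *
        (algebraMap F L (p.coeff j) * y ^ j) := by
      have : y ^ j = y ^ i * y ^ (j - i) := by rw [← pow_add, Nat.add_sub_cancel' hij.le]
      rw [this]
      field_simp
    have h2 : algebraMap F L (p.coeff i / p.coeff j) = (algebraMap F L (p.coeff j) * y ^ i)⁻¹ *
        (algebraMap F L (p.coeff i) * y ^ i) := by
      rw [map_div₀]
      field_simp
    rw [h1, h2, AddValuation.map_mul, ← h, ← AddValuation.map_mul]
  have hsum := map_sum_eq_inf u p.support (fun i => algebraMap F L (p.coeff i) * y ^ i)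
    (fun i hi j hj hij h => by
      rcases lt_or_gt_of_ne hij with h' | h'
      · exact absurd h (hlt i hi j hj h')
      · exact absurd h.symm (hlt j hj i hi h'))
  have h0 : ∑ i ∈ p.support, algebraMap F L (p.coeff i) * y ^ i = 0 := by
    rw [← hp, aeval_def, eval₂_eq_sum, Polynomial.sum]
  rw [h0, AddValuation.map_zero] at hsum
  obtain ⟨i, hi⟩ := nonempty_support_iff.2 hp0
  have htop := (Finset.inf_eq_top_iff _ _).1 hsum.symm i hi
  rw [AddValuation.top_iff, mul_eq_zero] at htop
  rcases htop with h | h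
  · exact mem_support_iff.1 hi (by simpa using h)
  · exact hy (eq_zero_of_pow_eq_zero h)

variable {Γ G : Type*} [AddCommGroup Γ] [LinearOrder Γ] [IsOrderedAddMonoid Γ]
  [LinearOrderedAddCommGroupWithTop G]

/-- `γ` is the value of `y` that is forced by `v`, if some positive power of `y` has the same value
under `u` as an element of `F`. -/
def IsForcedValue (v : AddValuation F (WithTop Γ)) (u : AddValuation L G) (y : L) (γ : Γ) : Prop :=
  ∃ n : ℕ, 0 < n ∧ ∃ c : F, u (y ^ n) = u (algebraMap F L c) ∧ ((n • γ : Γ) : WithTop Γ) = v c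

theorem IsForcedValue.mul {v : AddValuation F (WithTop Γ)} {u : AddValuation L G} {y z : L}
    {γ η : Γ} (hy : IsForcedValue v u y γ) (hz : IsForcedValue v u z η) :
    IsForcedValue v u (y * z) (γ + η) := by
  obtain ⟨n, hn, c, hc, hγ⟩ := hy
  obtain ⟨m, hm, d, hd, hη⟩ := hz
  refine ⟨n * m, Nat.mul_pos hn hm, c ^ m * d ^ n, ?_, ?_⟩
  · rw [mul_pow, pow_mul, mul_comm n m, pow_mul, AddValuation.map_mul, AddValuation.map_pow, hc,
      AddValuation.map_pow _ (z ^ m), hd, map_mul, map_pow, map_pow, AddValuation.map_mul,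
      AddValuation.map_pow, AddValuation.map_pow]
  · rw [AddValuation.map_mul, AddValuation.map_pow, AddValuation.map_pow, ← hγ, ← hη, smul_add,
      WithTop.coe_add, mul_comm n m, mul_smul, mul_comm m n, mul_smul, WithTop.coe_nsmul (n • γ),
      WithTop.coe_nsmul (m • η)]

/-- The powers with exponent `n * m` of both elements have values coming from `F`, where `huv`
applies. Used in both directions, this also gives uniqueness of the forced value. -/
theorem IsForcedValue.le {v : AddValuation F (WithTop Γ)} {u : AddValuation L G}
    (huv : ∀ c d : F, u (algebraMap F L c) ≤ u (algebraMap F L d) → v c ≤ v d) {y z : L} {γ η : Γ}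
    (hy : IsForcedValue v u y γ) (hz : IsForcedValue v u z η) (hyz : u y ≤ u z) : γ ≤ η := by
  obtain ⟨n, hn, c, hc, hγ⟩ := hy
  obtain ⟨m, hm, d, hd, hη⟩ := hz
  have h1 : u (algebraMap F L (c ^ m)) = (n * m) • u y := by
    rw [map_pow, AddValuation.map_pow, ← hc, ← AddValuation.map_pow, ← pow_mul,
      AddValuation.map_pow]
  have h2 : u (algebraMap F L (d ^ n)) = (n * m) • u z := by
    rw [map_pow, AddValuation.map_pow, ← hd, ← AddValuation.map_pow, ← pow_mul, mul_comm,
      AddValuation.map_pow]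
  have h := huv (c ^ m) (d ^ n) (by rw [h1, h2]; exact nsmul_le_nsmul_right hyz _)
  rw [AddValuation.map_pow, AddValuation.map_pow, ← hγ, ← hη, ← WithTop.coe_nsmul,
    ← WithTop.coe_nsmul, WithTop.coe_le_coe, ← mul_smul, ← mul_smul, mul_comm n m] at h
  exact le_of_nsmul_le_nsmul_right (Nat.mul_pos hm hn).ne' h

theorem exists_isForcedValue [Algebra.IsAlgebraic F L]
    (hΓ : ∀ n : ℕ, n ≠ 0 → ∀ γ : Γ, ∃ γ' : Γ, n • γ' = γ) (v : AddValuation F (WithTop Γ))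
    (u : AddValuation L G) {y : L} (hy : y ≠ 0) : ∃ γ, IsForcedValue v u y γ := by
  obtain ⟨n, hn, c, hc, h⟩ := exists_pow_val_eq (F := F) u hy
  obtain ⟨δ, hδ⟩ := WithTop.ne_top_iff_exists.1 ((AddValuation.ne_top_iff v).2 hc)
  obtain ⟨γ, hγ⟩ := hΓ n hn.ne' δ
  exact ⟨γ, n, hn, c, h, by rw [hγ, hδ]⟩

/-- The valuation of `B` has its own value group. Its values are transported into `Γ` by dividing
there: some positive multiple of each already comes from `F`. -/
theorem exists_algebraic_extension [Algebra.IsAlgebraic F L]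
    (hΓ : ∀ n : ℕ, n ≠ 0 → ∀ γ : Γ, ∃ γ' : Γ, n • γ' = γ) (v : AddValuation F (WithTop Γ)) :
    ∃ w : AddValuation L (WithTop Γ), ∀ c : F, w (algebraMap F L c) = v c := by
  classical
  obtain ⟨B, hB⟩ := exists_valuationSubring_extension (L := L) (AddValuation.toValuation v)
  let u := B.valuation.toAddValuation
  have huv : ∀ c d : F, u (algebraMap F L c) ≤ u (algebraMap F L d) → v c ≤ v d := fun c d h =>
    (Valuation.HasExtension.val_map_le_iff (AddValuation.toValuation v) B.valuation d c).1 h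
  choose! φ hφ using fun (y : L) (hy : y ≠ 0) => exists_isForcedValue hΓ v u hy
  have huniq : ∀ {y : L} {γ : Γ}, y ≠ 0 → IsForcedValue v u y γ → φ y = γ := fun hy h =>
    le_antisymm ((hφ _ hy).le huv h le_rfl) (h.le huv (hφ _ hy) le_rfl)
  have hone : ∀ {c : F} {γ : Γ}, v c = γ → IsForcedValue v u (algebraMap F L c) γ := fun h =>
    ⟨1, one_pos, _, by rw [pow_one], by rw [one_smul, h]⟩
  have hval : ∀ c : F, (if algebraMap F L c = 0 then (⊤ : WithTop Γ) else
      (φ (algebraMap F L c) : WithTop Γ)) = v c := by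
    intro c
    split_ifs with hc
    · rw [(map_eq_zero _).1 hc, AddValuation.map_zero]
    · obtain ⟨γ, hγ⟩ := WithTop.ne_top_iff_exists.1
        ((AddValuation.ne_top_iff v (x := c)).2 fun h => hc (by rw [h, map_zero]))
      rw [huniq hc (hone hγ.symm), hγ]
  refine ⟨AddValuation.of (fun y => if y = 0 then ⊤ else (φ y : WithTop Γ)) (by simp) ?_ ?_ ?_,
    fun c => ?_⟩
  · simpa using hval 1
  · intro y z
    by_cases hy : y = 0
    · simp [hy]
    by_cases hz : z = 0
    · simp [hz]
    by_cases hyz : y + z = 0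
    · simp [hyz]
    rw [if_neg hy, if_neg hz, if_neg hyz, min_le_iff, WithTop.coe_le_coe, WithTop.coe_le_coe]
    exact (u.map_add' y z).imp ((hφ y hy).le huv (hφ _ hyz)) ((hφ z hz).le huv (hφ _ hyz))
  · intro y z
    by_cases hy : y = 0
    · simp [hy]
    by_cases hz : z = 0
    · simp [hz]
    rw [if_neg hy, if_neg hz, if_neg (mul_ne_zero hy hz), ← WithTop.coe_add,
      huniq (mul_ne_zero hy hz) ((hφ y hy).mul (hφ z hz))]
  · exact hval c

end Extension

/-- Extend from `K(x)` to its algebraic closure, which contains a copy of the algebraic closure of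
`K`, and pull back along evaluation at `x`. -/
theorem exists_extendsToClosure {K Γ : Type*} [Field K] [AddCommGroup Γ] [LinearOrder Γ]
    [IsOrderedAddMonoid Γ] (hΓ : ∀ n : ℕ, n ≠ 0 → ∀ γ : Γ, ∃ γ' : Γ, n • γ' = γ)
    (ν : AddValuation K[X] (WithTop Γ)) (hν : IsKrull ν) :
    ∃ νbar : AddValuation (AlgebraicClosure K)[X] (WithTop Γ), ExtendsToClosure νbar ν := by
  obtain ⟨w, hw⟩ := exists_algebraic_extension (L := AlgebraicClosure (RatFunc K)) hΓ
    (AddValuation.ofValuation (fracValuation ν hν))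
  let ι : AlgebraicClosure K →ₐ[K] AlgebraicClosure (RatFunc K) := IsAlgClosed.lift
  refine ⟨w.comap (eval₂RingHom ι.toRingHom (algebraMap K[X] _ X)), fun f => ?_⟩
  change w (eval₂ ι.toRingHom (algebraMap K[X] _ X) (f.map _)) = _
  have h1 : eval₂ ι.toRingHom (algebraMap K[X] _ X) (f.map (algebraMap K (AlgebraicClosure K))) =
      algebraMap (RatFunc K) (AlgebraicClosure (RatFunc K)) (algebraMap K[X] (RatFunc K) f) := by
    rw [eval₂_map, ← IsScalarTower.algebraMap_apply]
    have h2 : ι.toRingHom.comp (algebraMap K (AlgebraicClosure K)) =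
        algebraMap K (AlgebraicClosure (RatFunc K)) := RingHom.ext fun c => ι.commutes c
    rw [h2, ← aeval_def, aeval_algebraMap_apply, aeval_X_left_apply]
  rw [h1, hw]
  exact Valuation.extendToLocalization_apply_map_apply (AddValuation.toValuation ν)
    hν.le_primeCompl (RatFunc K) f

end KeyPoly

end

noncomputable section

namespace KeyPoly

/-! ### Valuations with values in a lexicographic product -/

section Lex

variable {Γ : Type*} [AddCommGroup Γ]

/-- The first component, as a map from `Γ ×ₗ ℤ ∪ {∞}` to `Γ ∪ {∞}`. -/
def lexFst (Γ : Type*) [AddCommGroup Γ] : WithTop (Γ ×ₗ ℤ) →+ WithTop Γ :=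
  AddMonoidHom.withTopMap
    { toFun := fun p => (ofLex p).1, map_zero' := rfl, map_add' := fun _ _ => rfl }

/-- The embedding `γ ↦ (γ, 0)` of `Γ ∪ {∞}` into `Γ ×ₗ ℤ ∪ {∞}`. -/
def lexInl (Γ : Type*) [AddCommGroup Γ] : WithTop Γ →+ WithTop (Γ ×ₗ ℤ) :=
  AddMonoidHom.withTopMap
    { toFun := fun γ => toLex (γ, 0), map_zero' := rfl,
      map_add' := fun _ _ => congrArg toLex (Prod.ext rfl (add_zero (0 : ℤ)).symm) }

@[simp] theorem lexInl_top : lexInl Γ ⊤ = ⊤ := rfl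

@[simp] theorem lexFst_coe (γ : Γ) (k : ℤ) :
    lexFst Γ ((toLex (γ, k) : Γ ×ₗ ℤ) : WithTop (Γ ×ₗ ℤ)) = γ := rfl

@[simp] theorem lexInl_coe (γ : Γ) :
    lexInl Γ (γ : WithTop Γ) = ((toLex (γ, 0) : Γ ×ₗ ℤ) : WithTop (Γ ×ₗ ℤ)) := rfl

@[simp] theorem lexFst_lexInl (a : WithTop Γ) : lexFst Γ (lexInl Γ a) = a := by
  cases a <;> rfl

variable [LinearOrder Γ]

theorem lexFst_monotone : Monotone (lexFst Γ) :=
  WithTop.monotone_map_iff.2 Prod.Lex.monotone_fst_ofLex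

theorem lexInl_monotone : Monotone (lexInl Γ) :=
  WithTop.monotone_map_iff.2 fun _ _ h => Prod.Lex.toLex_mono ⟨h, le_rfl⟩

variable [IsOrderedAddMonoid Γ]

/-- The valuation formed by the first components of the values of `W`. -/
def fstVal {R : Type*} [Ring R] (W : AddValuation R (WithTop (Γ ×ₗ ℤ))) :
    AddValuation R (WithTop Γ) :=
  W.map (lexFst Γ) rfl lexFst_monotone

@[simp] theorem fstVal_apply {R : Type*} [Ring R] (W : AddValuation R (WithTop (Γ ×ₗ ℤ))) (f : R) :
    fstVal W f = lexFst Γ (W f) := rfl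

/-- If the value of `y` has a nonzero second component and the coefficients `c i` have values in
`Γ ∪ {∞}`, then the first component of the value of `∑ cᵢ yⁱ` is the minimum over all terms. -/
theorem fstVal_sum_mul_pow {R : Type*} [Ring R] (W : AddValuation R (WithTop (Γ ×ₗ ℤ)))
    {y : R} {γ : Γ} {k : ℤ} (hk : k ≠ 0)
    (hy : W y = ((toLex (γ, k) : Γ ×ₗ ℤ) : WithTop (Γ ×ₗ ℤ)))
    (s : Finset ℕ) (c : ℕ → R) (hc : ∀ i ∈ s, ∃ b : WithTop Γ, W (c i) = lexInl Γ b) :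
    fstVal W (∑ i ∈ s, c i * y ^ i) = s.inf fun i => fstVal W (c i * y ^ i) := by
  have hsum := map_sum_eq_inf W s (fun i => c i * y ^ i) fun i hi j hj hij h => by
    obtain ⟨b, hb⟩ := hc i hi
    obtain ⟨d, hd⟩ := hc j hj
    rw [AddValuation.map_mul, AddValuation.map_mul, AddValuation.map_pow, AddValuation.map_pow, hy,
      hb, hd] at h
    rw [AddValuation.map_mul, AddValuation.map_pow, hy, hb]
    cases b with
    | top => simp
    | coe b =>
      cases d with
      | top => simpa using h
      | coe d =>
        exfalso
        rw [lexInl_coe, lexInl_coe, ← WithTop.coe_nsmul, ← WithTop.coe_nsmul, ← WithTop.coe_add,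
          ← WithTop.coe_add, WithTop.coe_inj] at h
        -- The coefficients have second component `0`, so the second component of a term determines
        -- its exponent.
        have h2 : (0 : ℤ) + i • k = 0 + j • k := congrArg (fun p => (ofLex p).2) h
        rw [zero_add, zero_add, nsmul_eq_mul, nsmul_eq_mul] at h2
        exact hij (by exact_mod_cast mul_right_cancel₀ hk h2)
  rw [fstVal_apply, hsum]
  exact Finset.apply_inf_eq_inf_comp_of_linearOrder (lexFst Γ) lexFst_monotone rfl

end Lex

/-! ### Residue-transcendental valuations -/

section Residue

variable {K Γ : Type*} [Field K] [AddCommGroup Γ] [LinearOrder Γ] [IsOrderedAddMonoid Γ]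

/-- The residue of `z` is transcendental: a relation lifts to some `G` over the valuation ring with
`G(z)` of positive value, and `h` then makes every coefficient of the relation vanish. -/
theorem isResidueTranscendental_of_unit {ν₀ : AddValuation K (WithTop Γ)} (ν : ExtVal ν₀)
    (hK : IsKrull ν.1) (z : K[X]) (hz : ν.1 z = 0)
    (h : ∀ G : K[X], 0 < ν.1 (aeval z G) → ∀ i, 0 < ν₀ (G.coeff i)) :
    IsResidueTranscendental ν := by
  refine ⟨hK, ?_⟩
  let _ := fracValuation_hasExtension ν hK
  set O := (AddValuation.toValuation ν₀).valuationSubring with hO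
  set O' := (fracValuation ν.1 hK).valuationSubring with hO'
  have hfrac : ∀ f : K[X], fracValuation ν.1 hK (algebraMap K[X] (RatFunc K) f) =
      AddValuation.toValuation ν.1 f := fun f =>
    Valuation.extendToLocalization_apply_map_apply (AddValuation.toValuation ν.1)
      hK.le_primeCompl (RatFunc K) f
  have hz' : algebraMap K[X] (RatFunc K) z ∈ O' := by
    rw [hO', Valuation.mem_valuationSubring_iff, hfrac]
    exact hz.ge
  refine ⟨IsLocalRing.residue O' ⟨_, hz'⟩, ?_⟩
  rw [transcendental_iff]
  intro p hp
  obtain ⟨G, rfl⟩ := map_surjective _ (IsLocalRing.residue_surjective (R := O)) p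
  have hres : aeval (IsLocalRing.residue O' ⟨_, hz'⟩) (G.map (IsLocalRing.residue O)) =
      IsLocalRing.residue O' (aeval (⟨_, hz'⟩ : O') G) := by
    rw [aeval_def, eval₂_map, aeval_def, hom_eval₂]
    rfl
  have hcoe : ((aeval (⟨_, hz'⟩ : O') G : O') : RatFunc K) =
      algebraMap K[X] (RatFunc K) (aeval z (G.map O.subtype)) := by
    rw [aeval_def, aeval_def, eval₂_map, hom_eval₂]
    change O'.subtype _ = _
    rw [hom_eval₂]
    congr 1
  rw [hres, IsLocalRing.residue_eq_zero_iff] at hp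
  have hlt : fracValuation ν.1 hK ((aeval (⟨_, hz'⟩ : O') G : O') : RatFunc K) < 1 :=
    (Valuation.mem_maximalIdeal_iff _ _).1 hp
  rw [hcoe, hfrac] at hlt
  have hpos := h (G.map O.subtype) hlt
  ext i
  rw [coeff_map, coeff_zero, IsLocalRing.residue_eq_zero_iff]
  refine (Valuation.mem_maximalIdeal_iff _ _).2 ?_
  have := hpos i
  rw [coeff_map] at this
  exact this

/-- The element `c⁻¹ Pⁿ` has value `0` under `ν` but `(0, n k)` with `n k ≠ 0` under `W`. Hence the
value under `ν` of a polynomial in it is the minimum of the values of the coefficients. -/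
theorem isResidueTranscendental_of_lex {ν₀ : AddValuation K (WithTop Γ)} (ν : ExtVal ν₀)
    (hK : IsKrull ν.1) (W : AddValuation K[X] (WithTop (Γ ×ₗ ℤ)))
    (hW : ∀ f, fstVal W f = ν.1 f) (hC : ∀ c, W (C c) = lexInl Γ (ν₀ c))
    {P : K[X]} {γ : Γ} {k : ℤ} (hk : k ≠ 0)
    (hP : W P = ((toLex (γ, k) : Γ ×ₗ ℤ) : WithTop (Γ ×ₗ ℤ)))
    {n : ℕ} (hn : n ≠ 0) {c : K} (hc : ν₀ c = ((n • γ : Γ) : WithTop Γ)) :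
    IsResidueTranscendental ν := by
  have hc0 : c ≠ 0 := (AddValuation.ne_top_iff ν₀).1 (by rw [hc]; exact WithTop.coe_ne_top)
  have hinv : ν₀ c⁻¹ = ((-(n • γ) : Γ) : WithTop Γ) := by
    rw [AddValuation.map_inv, hc]; rfl
  have hz : W (C c⁻¹ * P ^ n) = ((toLex ((0 : Γ), n • k) : Γ ×ₗ ℤ) : WithTop (Γ ×ₗ ℤ)) := by
    rw [AddValuation.map_mul, AddValuation.map_pow, hC, hP, hinv, lexInl_coe, ← WithTop.coe_nsmul,
      ← WithTop.coe_add, WithTop.coe_inj]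
    refine congrArg toLex (Prod.ext ?_ ?_)
    · exact neg_add_cancel (n • γ)
    · exact zero_add (n • k)
  have hz0 : ν.1 (C c⁻¹ * P ^ n) = 0 := by
    rw [← hW, fstVal_apply, hz]; rfl
  refine isResidueTranscendental_of_unit ν hK _ hz0 fun G hG i => ?_
  by_cases hi : G.coeff i = 0
  · simp [hi]
  rw [aeval_eq_sum_range, ← hW] at hG
  simp only [smul_eq_C_mul] at hG
  rw [fstVal_sum_mul_pow W (by simpa using ⟨hn, hk⟩) hz _ _ fun i _ => ⟨_, hC _⟩] at hG
  have hi' : i ∈ Finset.range (G.natDegree + 1) :=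
    Finset.mem_range.2 (Nat.lt_succ_of_le (le_natDegree_of_ne_zero hi))
  have := hG.trans_le (Finset.inf_le hi')
  rwa [hW, AddValuation.map_mul, AddValuation.map_pow, hz0, smul_zero, add_zero, ν.2] at this

end Residue

end KeyPoly

end

noncomputable section

namespace KeyPoly

/-! ### Truncations over an algebraically closed field -/

section AlgClosed

variable {L Γ : Type*} [Field L] [AddCommGroup Γ] [LinearOrder Γ] [IsOrderedAddMonoid Γ]

/-- Induction over the linear factors of a nonzero polynomial over an algebraically closed field. -/
theorem induction_linear_factors [IsAlgClosed L] {p : L[X] → Prop} (hC : ∀ c : L, c ≠ 0 → p (C c))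
    (hmul : ∀ (b : L) (g : L[X]), g ≠ 0 → p g → p ((X - C b) * g)) {f : L[X]} (hf : f ≠ 0) :
    p f := by
  obtain ⟨n, hn⟩ : ∃ n, f.natDegree = n := ⟨_, rfl⟩
  induction n generalizing f with
  | zero =>
    rw [eq_C_of_natDegree_eq_zero hn] at hf ⊢
    exact hC _ (by simpa using hf)
  | succ n ih =>
    have hdeg : f.degree ≠ 0 := by
      intro h
      have := natDegree_eq_zero_iff_degree_le_zero.2 h.le
      omega
    obtain ⟨b, hb⟩ := IsAlgClosed.exists_root f hdeg
    obtain ⟨g, rfl⟩ := dvd_iff_isRoot.2 hb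
    have hg : g ≠ 0 := right_ne_zero_of_mul hf
    refine hmul b g hg (ih hg ?_)
    rw [natDegree_mul (X_sub_C_ne_zero b) hg, natDegree_X_sub_C] at hn
    omega

/-- The Gauss valuation with centre `a` that extends the restriction of `ν` to constants and takes
at `x - a` a value infinitesimally smaller than `γ`. -/
def lexGauss (ν : AddValuation L[X] (WithTop Γ)) (a : L) (γ : Γ) :
    AddValuation L[X] (WithTop (Γ ×ₗ ℤ)) :=
  gaussValAt ((ν.comap C).map (lexInl Γ) rfl lexInl_monotone) a (toLex (γ, -1))

variable {ν : AddValuation L[X] (WithTop Γ)} {a : L} {γ : Γ}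

theorem lexGauss_C (ν : AddValuation L[X] (WithTop Γ)) (a : L) (γ : Γ) (c : L) :
    lexGauss ν a γ (C c) = lexInl Γ (ν (C c)) :=
  gaussValAt_C _ _ _ _

theorem lexGauss_center (ν : AddValuation L[X] (WithTop Γ)) (a : L) (γ : Γ) :
    lexGauss ν a γ (X - C a) = ((toLex (γ, -1) : Γ ×ₗ ℤ) : WithTop (Γ ×ₗ ℤ)) := by
  rw [lexGauss, gaussValAt_X_sub_C, sub_self, AddValuation.map_zero, min_top_right]

theorem lexGauss_X_sub_C_of_lt (ha : ν (X - C a) = γ) {b : L} (hb : ν (X - C b) < γ) :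
    lexGauss ν a γ (X - C b) = lexInl Γ (ν (X - C b)) := by
  have h : ν (C (b - a)) = ν (X - C b) := by
    have : C (b - a) = (X - C a) - (X - C b) := by rw [C_sub]; ring
    rw [this]
    exact AddValuation.map_sub_eq_of_lt_right ν (by rwa [ha])
  rw [lexGauss, gaussValAt_X_sub_C]
  change min _ (lexInl Γ (ν (C (b - a)))) = _
  rw [h, min_eq_right]
  obtain ⟨η, hη⟩ := WithTop.ne_top_iff_exists.1 (ne_top_of_lt hb)
  rw [← hη, WithTop.coe_lt_coe] at hb
  rw [← hη, lexInl_coe, WithTop.coe_le_coe]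
  exact (Prod.Lex.toLex_lt_toLex.2 (Or.inl hb)).le

/-- The second component `-1` makes `(γ, -1)` the minimum even when `ν (C (b - a)) = γ`. -/
theorem lexGauss_X_sub_C_of_le (ha : ν (X - C a) = γ) {b : L} (hb : γ ≤ ν (X - C b)) :
    lexGauss ν a γ (X - C b) = ((toLex (γ, -1) : Γ ×ₗ ℤ) : WithTop (Γ ×ₗ ℤ)) := by
  have h : γ ≤ ν (C (b - a)) := by
    have : C (b - a) = (X - C a) - (X - C b) := by rw [C_sub]; ring
    rw [this]
    exact AddValuation.map_le_sub ν ha.ge hb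
  rw [lexGauss, gaussValAt_X_sub_C]
  change min _ (lexInl Γ (ν (C (b - a)))) = _
  rw [min_eq_left]
  refine le_trans ?_ (lexInl_monotone h)
  rw [lexInl_coe, WithTop.coe_le_coe]
  exact Prod.Lex.toLex_mono ⟨le_rfl, by norm_num⟩

theorem fstVal_lexGauss_X_sub_C (ha : ν (X - C a) = γ) (b : L) :
    fstVal (lexGauss ν a γ) (X - C b) = min (γ : WithTop Γ) (ν (X - C b)) := by
  rcases lt_or_ge (ν (X - C b)) γ with h | h
  · rw [fstVal_apply, lexGauss_X_sub_C_of_lt ha h, lexFst_lexInl, min_eq_right h.le]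
  · rw [fstVal_apply, lexGauss_X_sub_C_of_le ha h, lexFst_coe, min_eq_left h]

theorem fstVal_lexGauss_C (ν : AddValuation L[X] (WithTop Γ)) (a : L) (γ : Γ) (c : L) :
    fstVal (lexGauss ν a γ) (C c) = ν (C c) := by
  rw [fstVal_apply, lexGauss_C, lexFst_lexInl]

variable [IsAlgClosed L]

theorem lexGauss_of_roots_lt (ha : ν (X - C a) = γ) {f : L[X]} (hf : f ≠ 0)
    (hroots : ∀ b, f.IsRoot b → ν (X - C b) < γ) : lexGauss ν a γ f = lexInl Γ (ν f) := by
  refine induction_linear_factors (p := fun f => (∀ b, f.IsRoot b → ν (X - C b) < γ) →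
    lexGauss ν a γ f = lexInl Γ (ν f)) (fun c _ _ => lexGauss_C ν a γ c)
    (fun b g _ ih h => ?_) hf hroots
  rw [AddValuation.map_mul, AddValuation.map_mul, map_add,
    ih fun b hb => h b (root_mul_left_of_isRoot _ hb),
    lexGauss_X_sub_C_of_lt ha (h b (by simp))]

theorem fstVal_lexGauss_of_roots_le (ha : ν (X - C a) = γ) {f : L[X]} (hf : f ≠ 0)
    (hroots : ∀ b, f.IsRoot b → ν (X - C b) ≤ γ) : fstVal (lexGauss ν a γ) f = ν f := by
  refine induction_linear_factors (p := fun f => (∀ b, f.IsRoot b → ν (X - C b) ≤ γ) →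
    fstVal (lexGauss ν a γ) f = ν f) (fun c _ _ => fstVal_lexGauss_C ν a γ c)
    (fun b g _ ih h => ?_) hf hroots
  rw [AddValuation.map_mul, AddValuation.map_mul,
    ih fun b hb => h b (root_mul_left_of_isRoot _ hb),
    fstVal_lexGauss_X_sub_C ha, min_eq_right (h b (by simp))]

theorem fstVal_lexGauss_le (ha : ν (X - C a) = γ) (f : L[X]) :
    fstVal (lexGauss ν a γ) f ≤ ν f := by
  by_cases hf : f = 0
  · simp [hf]
  refine induction_linear_factors (p := fun f => fstVal (lexGauss ν a γ) f ≤ ν f)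
    (fun c _ => (fstVal_lexGauss_C ν a γ c).le) (fun b g _ ih => ?_) hf
  rw [AddValuation.map_mul, AddValuation.map_mul, fstVal_lexGauss_X_sub_C ha]
  exact add_le_add (min_le_right _ _) ih

theorem fstVal_lexGauss_mono (ha : ν (X - C a) = γ) {b : L} {η : Γ} (hb : ν (X - C b) = η)
    (h : γ ≤ η) (f : L[X]) : fstVal (lexGauss ν a γ) f ≤ fstVal (lexGauss ν b η) f := by
  by_cases hf : f = 0
  · simp [hf]
  refine induction_linear_factors
    (p := fun f => fstVal (lexGauss ν a γ) f ≤ fstVal (lexGauss ν b η) f)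
    (fun c _ => ?_) (fun c g _ ih => ?_) hf
  · rw [fstVal_lexGauss_C, fstVal_lexGauss_C]
  · rw [AddValuation.map_mul, AddValuation.map_mul, fstVal_lexGauss_X_sub_C ha,
      fstVal_lexGauss_X_sub_C hb]
    exact add_le_add (min_le_min_right _ (WithTop.coe_le_coe.2 h)) ih

theorem ne_top_of_linear_ne_top (hν : ∀ b, ν (X - C b) ≠ ⊤) {f : L[X]} (hf : f ≠ 0) : ν f ≠ ⊤ := by
  refine induction_linear_factors (p := fun f => ν f ≠ ⊤) (fun c hc => ?_) (fun b g _ ih => ?_) hf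
  · exact (AddValuation.ne_top_iff (ν.comap C)).2 hc
  · rw [AddValuation.map_mul, WithTop.add_ne_top]
    exact ⟨hν b, ih⟩

theorem fstVal_lexGauss_lt (hν : ∀ b, ν (X - C b) ≠ ⊤) (ha : ν (X - C a) = γ) {f : L[X]}
    (hf : f ≠ 0) {b : L} (hb : f.IsRoot b) (h : γ < ν (X - C b)) :
    fstVal (lexGauss ν a γ) f < ν f := by
  obtain ⟨g, rfl⟩ := dvd_iff_isRoot.2 hb
  rw [AddValuation.map_mul, AddValuation.map_mul, fstVal_lexGauss_X_sub_C ha, min_eq_left h.le]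
  exact (add_le_add_right (fstVal_lexGauss_le ha g) _).trans_lt
    (WithTop.add_lt_add_right (ne_top_of_linear_ne_top hν (right_ne_zero_of_mul hf)) h)

/-- Each linear factor contributes `0` or `-1` to the second component. The sign excludes
cancellation, so a root at `a` makes that component nonzero. -/
theorem exists_lexGauss_eq (hν : ∀ b, ν (X - C b) ≠ ⊤) (ha : ν (X - C a) = γ) {f : L[X]}
    (hf : f ≠ 0) : ∃ (η : Γ) (k : ℤ), k ≤ 0 ∧
      lexGauss ν a γ f = ((toLex (η, k) : Γ ×ₗ ℤ) : WithTop (Γ ×ₗ ℤ)) := by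
  refine induction_linear_factors (p := fun f => ∃ (η : Γ) (k : ℤ), k ≤ 0 ∧
      lexGauss ν a γ f = ((toLex (η, k) : Γ ×ₗ ℤ) : WithTop (Γ ×ₗ ℤ)))
      (fun c hc => ?_) (fun b g _ ih => ?_) hf
  · obtain ⟨η, hη⟩ := WithTop.ne_top_iff_exists.1 (ne_top_of_linear_ne_top hν (C_ne_zero.2 hc))
    exact ⟨η, 0, le_rfl, by rw [lexGauss_C, ← hη, lexInl_coe]⟩
  · obtain ⟨η, k, hk, h⟩ := ih
    rw [AddValuation.map_mul, h]
    rcases lt_or_ge (ν (X - C b)) γ with hlt | hle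
    · obtain ⟨ζ, hζ⟩ := WithTop.ne_top_iff_exists.1 (hν b)
      refine ⟨ζ + η, 0 + k, by omega, ?_⟩
      rw [lexGauss_X_sub_C_of_lt ha hlt, ← hζ, lexInl_coe, ← WithTop.coe_add]
      rfl
    · refine ⟨γ + η, -1 + k, by omega, ?_⟩
      rw [lexGauss_X_sub_C_of_le ha hle, ← WithTop.coe_add]
      rfl

theorem exists_lexGauss_eq_of_isRoot (hν : ∀ b, ν (X - C b) ≠ ⊤) (ha : ν (X - C a) = γ) {f : L[X]}
    (hf : f ≠ 0) (hroot : f.IsRoot a) : ∃ (η : Γ) (k : ℤ), k ≠ 0 ∧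
      lexGauss ν a γ f = ((toLex (η, k) : Γ ×ₗ ℤ) : WithTop (Γ ×ₗ ℤ)) := by
  obtain ⟨g, rfl⟩ := dvd_iff_isRoot.2 hroot
  obtain ⟨η, k, hk, h⟩ := exists_lexGauss_eq hν ha (right_ne_zero_of_mul hf)
  refine ⟨γ + η, -1 + k, by omega, ?_⟩
  rw [AddValuation.map_mul, h, lexGauss_center, ← WithTop.coe_add]
  rfl

end AlgClosed

/-! ### Expansions -/

section Expansion

variable {K Γ : Type*} [Field K] [AddCommGroup Γ] [LinearOrder Γ] [IsOrderedAddMonoid Γ]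

theorem sum_expansionCoeff_add (q f : K[X]) (n : ℕ) :
    ∑ i ∈ Finset.range n, expansionCoeff q f i * q ^ i + (fun g : K[X] => g / q)^[n] f * q ^ n =
      f := by
  induction n with
  | zero => simp
  | succ n ih =>
    rw [Finset.sum_range_succ, Function.iterate_succ_apply']
    conv_rhs => rw [← ih, ← EuclideanDomain.div_add_mod ((fun g : K[X] => g / q)^[n] f) q]
    rw [expansionCoeff]
    ring

theorem natDegree_iterate_div_le {q : K[X]} (hq : 0 < q.natDegree) (f : K[X]) (n : ℕ) :
    ((fun g : K[X] => g / q)^[n] f).natDegree ≤ f.natDegree - n := by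
  induction n with
  | zero => simp
  | succ n ih =>
    rw [Function.iterate_succ_apply', div_def]
    refine (natDegree_C_mul_le _ _).trans ?_
    rw [natDegree_divByMonic _ (monic_mul_leadingCoeff_inv (ne_zero_of_natDegree_gt hq)),
      natDegree_mul_leadingCoeff_inv _ (ne_zero_of_natDegree_gt hq)]
    omega

theorem sum_expansionCoeff {q : K[X]} (hq : 0 < q.natDegree) (f : K[X]) :
    ∑ i ∈ Finset.range (f.natDegree + 1), expansionCoeff q f i * q ^ i = f := by
  have h := sum_expansionCoeff_add q f (f.natDegree + 1)
  have hdeg := natDegree_iterate_div_le hq f f.natDegree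
  have hq0 : q ≠ 0 := by rintro rfl; simp at hq
  -- After `f.natDegree` divisions the quotient is constant; one more makes it zero.
  have h0 : (fun g : K[X] => g / q)^[f.natDegree + 1] f = 0 := by
    rw [Function.iterate_succ_apply']
    refine (Polynomial.div_eq_zero_iff hq0).2 ?_
    exact degree_lt_degree (by omega)
  rwa [h0, zero_mul, add_zero] at h

theorem natDegree_expansionCoeff_lt {q : K[X]} (hq : 0 < q.natDegree) (f : K[X]) (i : ℕ) :
    (expansionCoeff q f i).natDegree < q.natDegree :=
  natDegree_mod_lt _ hq.ne'

end Expansion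

end KeyPoly

end

noncomputable section

namespace KeyPoly

section Truncation

variable {K Γ : Type*} [Field K] [AddCommGroup Γ] [LinearOrder Γ] [IsOrderedAddMonoid Γ]

local notation "ι" => algebraMap K (AlgebraicClosure K)

/-! ### The function `δ` -/

section Delta

theorem le_sup_coe {α β : Type*} [LinearOrder β] {s : Finset α} (g : α → WithTop β) {b : α}
    (hb : b ∈ s) : (g b : WithBot (WithTop β)) ≤ s.sup fun a => (g a : WithBot (WithTop β)) :=
  Finset.le_sup (f := fun a => (g a : WithBot (WithTop β))) hb

variable {νbar : AddValuation (AlgebraicClosure K)[X] (WithTop Γ)} {f : (AlgebraicClosure K)[X]}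

theorem le_delta (hf : f ≠ 0) {b : AlgebraicClosure K} (hb : f.IsRoot b) :
    ((νbar (X - C b) : WithTop Γ) : WithBot (WithTop Γ)) ≤ delta νbar f := by
  classical
  have hmem : b ∈ f.roots := (mem_roots hf).2 hb
  have h := le_sup_coe (fun a => νbar (X - C a)) (Multiset.mem_toFinset.2 hmem)
  rw [delta]
  convert h

theorem exists_isRoot_delta_eq (hf : 0 < f.natDegree) :
    ∃ a, f.IsRoot a ∧ delta νbar f = ((νbar (X - C a) : WithTop Γ) : WithBot (WithTop Γ)) := by
  classical
  have hf0 : f ≠ 0 := ne_zero_of_natDegree_gt hf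
  obtain ⟨b, hb⟩ := IsAlgClosed.exists_root f (natDegree_pos_iff_degree_pos.1 hf).ne'
  have hne : f.roots.toFinset.Nonempty := ⟨b, Multiset.mem_toFinset.2 ((mem_roots hf0).2 hb)⟩
  obtain ⟨a, ha, h⟩ := Finset.exists_mem_eq_sup _ hne
    fun a => ((νbar (X - C a) : WithTop Γ) : WithBot (WithTop Γ))
  exact ⟨a, (mem_roots hf0).1 (Multiset.mem_toFinset.1 ha), h⟩

theorem delta_C_mul {c : AlgebraicClosure K} (hc : c ≠ 0) : delta νbar (C c * f) = delta νbar f := by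
  rw [delta, delta, roots_C_mul _ hc]

theorem exists_delta_le (νbar : AddValuation (AlgebraicClosure K)[X] (WithTop Γ))
    (f : (AlgebraicClosure K)[X]) :
    ∃ b, delta νbar f ≤ ((νbar (X - C b) : WithTop Γ) : WithBot (WithTop Γ)) := by
  rcases Nat.eq_zero_or_pos f.natDegree with h | h
  · exact ⟨0, by rw [eq_C_of_natDegree_eq_zero h, delta, roots_C]; simp⟩
  · obtain ⟨a, -, ha⟩ := exists_isRoot_delta_eq (νbar := νbar) h
    exact ⟨a, ha.le⟩

theorem natDegree_pos_of_le_delta {b : WithTop Γ} (h : (b : WithBot (WithTop Γ)) ≤ delta νbar f) :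
    0 < f.natDegree := by
  classical
  by_contra hdeg
  rw [eq_C_of_natDegree_eq_zero (Nat.eq_zero_of_not_pos hdeg), delta, roots_C] at h
  simp at h

end Delta

/-! ### Restrictions of Gauss valuations to `K[x]` -/

variable {ν₀ : AddValuation K (WithTop Γ)} {ν : ExtVal ν₀}
  {νbar : AddValuation (AlgebraicClosure K)[X] (WithTop Γ)}

/-- Otherwise the minimal polynomial of `b` would be a nonzero element of the support of `ν`. -/
theorem linear_ne_top (hK : IsKrull ν.1) (hext : ExtendsToClosure νbar ν.1)
    (b : AlgebraicClosure K) : νbar (X - C b) ≠ ⊤ := by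
  intro h
  have hb : IsIntegral K b := Algebra.IsIntegral.isIntegral b
  obtain ⟨g, hg⟩ : X - C b ∣ (minpoly K b).map ι := by
    rw [dvd_iff_isRoot, IsRoot.def, eval_map_algebraMap, minpoly.aeval]
  refine minpoly.ne_zero hb (hK _ ?_)
  rw [← hext, hg, AddValuation.map_mul, h, top_add]

/-- The restriction to `K[x]` of the Gauss valuation with centre `a` and value `γ`. -/
def restrictGauss (hext : ExtendsToClosure νbar ν.1) (a : AlgebraicClosure K) (γ : Γ) :
    ExtVal ν₀ :=
  ⟨fstVal ((lexGauss νbar a γ).comap (mapRingHom ι)), fun c => by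
    change fstVal (lexGauss νbar a γ) ((C c).map ι) = _
    rw [map_C, fstVal_lexGauss_C, ← map_C, hext, ν.2]⟩

theorem restrictGauss_apply (hext : ExtendsToClosure νbar ν.1) (a : AlgebraicClosure K) (γ : Γ)
    (f : K[X]) : (restrictGauss hext a γ).1 f = fstVal (lexGauss νbar a γ) (f.map ι) := rfl

theorem restrictGauss_isKrull (hK : IsKrull ν.1) (hext : ExtendsToClosure νbar ν.1)
    {a : AlgebraicClosure K} {γ : Γ} (ha : νbar (X - C a) = γ) :
    IsKrull (restrictGauss hext a γ).1 := by
  intro f hf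
  by_contra hf0
  obtain ⟨η, k, -, h⟩ := exists_lexGauss_eq (linear_ne_top hK hext) ha
    ((Polynomial.map_ne_zero_iff (algebraMap K (AlgebraicClosure K)).injective).2 hf0)
  rw [restrictGauss_apply, fstVal_apply, h, lexFst_coe] at hf
  exact WithTop.coe_ne_top hf

/-- The bound is asked only for `f ≠ 0`, since every `b` is a root of `0`; expansion coefficients
may vanish. -/
theorem restrictGauss_eq (hext : ExtendsToClosure νbar ν.1) {a : AlgebraicClosure K} {γ : Γ}
    (ha : νbar (X - C a) = γ) {f : K[X]}
    (h : ∀ b, (f.map ι).IsRoot b → f ≠ 0 → νbar (X - C b) ≤ γ) :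
    (restrictGauss hext a γ).1 f = ν.1 f := by
  by_cases hf : f = 0
  · simp [hf]
  rw [restrictGauss_apply, fstVal_lexGauss_of_roots_le ha (by simpa using hf)
    (fun b hb => h b hb hf), hext]

theorem exists_mem_valueGroup (ν₀ : AddValuation K (WithTop Γ)) {γ : Γ} (hγ : γ ∈ valueGroup ν₀) :
    ∃ c : K, ν₀ c = (γ : WithTop Γ) := by
  induction hγ using AddSubgroup.closure_induction with
  | mem γ h => exact h
  | zero => exact ⟨1, AddValuation.map_one _⟩
  | add γ η _ _ h1 h2 =>
    obtain ⟨c, hc⟩ := h1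
    obtain ⟨d, hd⟩ := h2
    exact ⟨c * d, by rw [AddValuation.map_mul, hc, hd, WithTop.coe_add]⟩
  | neg γ _ h =>
    obtain ⟨c, hc⟩ := h
    exact ⟨c⁻¹, by rw [AddValuation.map_inv, hc]; rfl⟩

theorem exists_nsmul_value_eq (h : ¬ IsValueTranscendental ν) {f : K[X]} {γ : Γ}
    (hf : ν.1 f = γ) : ∃ n : ℕ, n ≠ 0 ∧ ∃ c : K, ν₀ c = ((n • γ : Γ) : WithTop Γ) := by
  rw [IsValueTranscendental, not_or, not_not, not_not] at h
  have hγ : γ ∈ valueGroup ν.1 := AddSubgroup.subset_closure ⟨f, hf⟩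
  obtain ⟨n, hn, hmem⟩ := isOfFinAddOrder_iff_nsmul_eq_zero.1
    (h.2 (QuotientAddGroup.mk (⟨γ, hγ⟩ : valueGroup ν.1)))
  rw [← QuotientAddGroup.mk_nsmul, QuotientAddGroup.eq_zero_iff, AddSubgroup.mem_addSubgroupOf]
    at hmem
  exact ⟨n, hn.ne', exists_mem_valueGroup ν₀ hmem⟩

/-- A Gauss valuation centred at a root of a polynomial none of whose roots is closer than the
centre restricts to a residue-transcendental valuation. -/
theorem restrictGauss_isResidueTranscendental (hV : ¬ IsValueTranscendental ν)
    (hext : ExtendsToClosure νbar ν.1) {a : AlgebraicClosure K} {γ : Γ} (ha : νbar (X - C a) = γ)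
    {P : K[X]} (hP : P ≠ 0) (hroot : (P.map ι).IsRoot a)
    (hmax : ∀ b, (P.map ι).IsRoot b → νbar (X - C b) ≤ γ) :
    IsResidueTranscendental (restrictGauss hext a γ) := by
  have hK : IsKrull ν.1 := not_not.1 (not_or.1 hV).1
  obtain ⟨η, k, hk, h⟩ := exists_lexGauss_eq_of_isRoot (linear_ne_top hK hext) ha
    ((Polynomial.map_ne_zero_iff (algebraMap K (AlgebraicClosure K)).injective).2 hP) hroot
  have hη : ν.1 P = η := by
    rw [← restrictGauss_eq hext ha fun b hb _ => hmax b hb, restrictGauss_apply, fstVal_apply, h,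
      lexFst_coe]
  obtain ⟨n, hn, c, hc⟩ := exists_nsmul_value_eq hV hη
  refine isResidueTranscendental_of_lex _ (restrictGauss_isKrull hK hext ha)
    ((lexGauss νbar a γ).comap (mapRingHom ι)) (fun _ => rfl) (fun c => ?_) hk h hn hc
  change lexGauss νbar a γ ((C c).map ι) = _
  rw [map_C, lexGauss_C, ← map_C, hext, ν.2]

/-- If `a` were a closest centre, the Gauss valuation at `a` would restrict to `ν`. Applied to the
minimal polynomial of `a`, the preceding theorem would make `ν` residue-transcendental. -/
theorem exists_linear_lt (hν : IsValuationAlgebraic ν) (hext : ExtendsToClosure νbar ν.1)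
    (a : AlgebraicClosure K) : ∃ b, νbar (X - C a) < νbar (X - C b) := by
  by_contra! hcon
  obtain ⟨hV, hR⟩ := not_or.1 hν
  have hK : IsKrull ν.1 := not_not.1 (not_or.1 hV).1
  obtain ⟨γ, hγ⟩ := WithTop.ne_top_iff_exists.1 (linear_ne_top hK hext a)
  have hres := restrictGauss_isResidueTranscendental hV hext hγ.symm
    (minpoly.ne_zero (Algebra.IsIntegral.isIntegral (R := K) a))
    (by rw [IsRoot.def, eval_map_algebraMap, minpoly.aeval]) fun b _ => hγ ▸ hcon b
  have heq : restrictGauss hext a γ = ν := Subtype.ext (AddValuation.ext fun f =>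
    restrictGauss_eq hext hγ.symm fun b _ _ => hγ ▸ hcon b)
  exact hR (heq ▸ hres)

/-! ### Key polynomials -/

/-- `Q` is a key polynomial, with `δ` computed by the extension `νbar`. -/
def IsKeyFor (νbar : AddValuation (AlgebraicClosure K)[X] (WithTop Γ)) (Q : K[X]) : Prop :=
  Q.Monic ∧ 0 < Q.natDegree ∧ ∀ f : K[X], f ≠ 0 →
    delta νbar (Q.map ι) ≤ delta νbar (f.map ι) → Q.natDegree ≤ f.natDegree

/-- Take a polynomial of least degree among those with `δ` at least `νbar (X - C a)`; the minimal
polynomial of `a` is a candidate. Scaling to a monic one changes neither roots nor `δ`, and any `g`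
with `δ` at least as large is again a candidate. -/
theorem exists_isKeyFor (νbar : AddValuation (AlgebraicClosure K)[X] (WithTop Γ))
    (a : AlgebraicClosure K) : ∃ Q : K[X], IsKeyFor νbar Q ∧
      ((νbar (X - C a) : WithTop Γ) : WithBot (WithTop Γ)) ≤ delta νbar (Q.map ι) := by
  classical
  have hint : IsIntegral K a := Algebra.IsIntegral.isIntegral a
  have hex : ∃ n : ℕ, ∃ f : K[X], f ≠ 0 ∧
      ((νbar (X - C a) : WithTop Γ) : WithBot (WithTop Γ)) ≤ delta νbar (f.map ι) ∧
      f.natDegree = n :=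
    ⟨_, minpoly K a, minpoly.ne_zero hint,
      le_delta ((minpoly.monic hint).map _).ne_zero
        (by rw [IsRoot.def, eval_map_algebraMap, minpoly.aeval]), rfl⟩
  obtain ⟨f, hf0, hf, hdeg⟩ := Nat.find_spec hex
  have hlc : f.leadingCoeff⁻¹ ≠ 0 := inv_ne_zero (leadingCoeff_ne_zero.2 hf0)
  have hδ : delta νbar ((C f.leadingCoeff⁻¹ * f).map ι) = delta νbar (f.map ι) := by
    rw [Polynomial.map_mul, map_C, delta_C_mul (by simpa using hf0)]
  have hnat : (C f.leadingCoeff⁻¹ * f).natDegree = f.natDegree := natDegree_C_mul hlc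
  refine ⟨C f.leadingCoeff⁻¹ * f, ⟨?_, ?_, fun g hg h => ?_⟩, hδ ▸ hf⟩
  · rw [mul_comm]
    exact monic_mul_leadingCoeff_inv hf0
  · rw [hnat]
    have := natDegree_pos_of_le_delta hf
    rwa [natDegree_map] at this
  · rw [hnat, hdeg]
    rw [hδ] at h
    exact Nat.find_min' hex ⟨g, hg, hf.trans h, rfl⟩

/-- The centre `a` and the value `γ` describe the key polynomial `Q`: `a` is a root of `Q` with
`δ(Q) = νbar (x - a) = γ`. -/
def IsCenter (νbar : AddValuation (AlgebraicClosure K)[X] (WithTop Γ)) (Q : K[X])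
    (a : AlgebraicClosure K) (γ : Γ) : Prop :=
  (Q.map ι).IsRoot a ∧ νbar (X - C a) = γ ∧
    delta νbar (Q.map ι) = ((γ : WithTop Γ) : WithBot (WithTop Γ))

theorem IsKeyFor.exists_isCenter (hK : IsKrull ν.1) (hext : ExtendsToClosure νbar ν.1) {Q : K[X]}
    (hQ : IsKeyFor νbar Q) : ∃ p : AlgebraicClosure K × Γ, IsCenter νbar Q p.1 p.2 := by
  have hdeg : 0 < (Q.map ι).natDegree := by rw [natDegree_map]; exact hQ.2.1
  obtain ⟨a, ha, h⟩ := exists_isRoot_delta_eq (νbar := νbar) hdeg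
  obtain ⟨γ, hγ⟩ := WithTop.ne_top_iff_exists.1 (linear_ne_top hK hext a)
  exact ⟨(a, γ), ha, hγ.symm, by rw [h, hγ]⟩

theorem IsCenter.linear_le {Q : K[X]} {a : AlgebraicClosure K} {γ : Γ} (hc : IsCenter νbar Q a γ)
    {f : K[X]} (hf : f ≠ 0) (hle : delta νbar (f.map ι) ≤ delta νbar (Q.map ι))
    {b : AlgebraicClosure K} (hb : (f.map ι).IsRoot b) : νbar (X - C b) ≤ γ := by
  have h := (le_delta (νbar := νbar) (by simpa using hf) hb).trans hle
  rwa [hc.2.2, WithBot.coe_le_coe] at h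

/-- Expansion coefficients have degree below `deg Q`, so the nonzero ones have `δ` below `γ` by the
key property and their lexicographic values have second component `0`, whereas that of `Q` is
nonzero. The terms therefore do not cancel, and the Gauss valuation agrees with `ν` on each of them.
-/
theorem IsCenter.restrictGauss_eq_truncation (hext : ExtendsToClosure νbar ν.1) {Q : K[X]}
    (hQ : IsKeyFor νbar Q) {a : AlgebraicClosure K} {γ : Γ} (hc : IsCenter νbar Q a γ)
    (hK : IsKrull ν.1) (f : K[X]) : (restrictGauss hext a γ).1 f = truncation ν.1 Q f := by
  have hQ0 : Q ≠ 0 := hQ.1.ne_zero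
  have ha := hc.2.1
  obtain ⟨η, k, hk, hη⟩ := exists_lexGauss_eq_of_isRoot (linear_ne_top hK hext) ha
    ((Polynomial.map_ne_zero_iff (algebraMap K (AlgebraicClosure K)).injective).2 hQ0) hc.1
  have hsmall : ∀ g : K[X], g.natDegree < Q.natDegree → g ≠ 0 →
      delta νbar (g.map ι) < delta νbar (Q.map ι) := fun g hg hg0 =>
    lt_of_not_ge fun h => (hQ.2.2 g hg0 h).not_gt hg
  conv_lhs => rw [← sum_expansionCoeff hQ.2.1 f]
  change fstVal ((lexGauss νbar a γ).comap (mapRingHom ι)) _ = _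
  rw [fstVal_sum_mul_pow _ hk (y := Q) hη]
  · refine Finset.inf_congr rfl fun i _ => ?_
    change (restrictGauss hext a γ).1 _ = _
    rw [AddValuation.map_mul, AddValuation.map_pow, AddValuation.map_mul, AddValuation.map_pow,
      restrictGauss_eq hext ha fun b hb hg =>
        hc.linear_le hg (hsmall _ (natDegree_expansionCoeff_lt hQ.2.1 f i) hg).le hb,
      restrictGauss_eq hext ha fun b hb hg => hc.linear_le hg le_rfl hb]
  · intro i _
    refine ⟨νbar ((expansionCoeff Q f i).map ι), ?_⟩
    change lexGauss νbar a γ ((expansionCoeff Q f i).map ι) = _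
    by_cases h0 : expansionCoeff Q f i = 0
    · simp [h0]
    refine lexGauss_of_roots_lt ha (by simpa using h0) fun b hb => ?_
    have h := (le_delta (νbar := νbar) (by simpa using h0) hb).trans_lt
      (hsmall _ (natDegree_expansionCoeff_lt hQ.2.1 f i) h0)
    rwa [hc.2.2, WithBot.coe_lt_coe] at h

end Truncation

end KeyPoly

end

/-! ### The family of truncations at all key polynomials -/

theorem mainTheorem7 {K Γ : Type*} [Field K]
    [AddCommGroup Γ] [LinearOrder Γ] [IsOrderedAddMonoid Γ]
    (hΓ : ∀ n : ℕ, n ≠ 0 → ∀ γ : Γ, ∃ γ' : Γ, n • γ' = γ)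
    (ν₀ : AddValuation K (WithTop Γ)) (ν : ExtVal ν₀) (hν : IsValuationAlgebraic ν) :
    ∃ (QQ : Set K[X]) (νQ : QQ → ExtVal ν₀),
      (∀ Q : QQ, IsKeyPolynomial ν.1 (Q : K[X])) ∧
      (∀ (Q : QQ) (f : K[X]), (νQ Q).1 f = truncation ν.1 (Q : K[X]) f) ∧
      IsChain (· ≤ ·) (Set.range νQ) ∧
      (∀ μ : ExtVal ν₀, ¬ Maximal (· ∈ Set.range νQ) μ) ∧
      (∀ f : K[X], IsStable (Set.range νQ) f) ∧
      IsStableSup (Set.range νQ) ν ∧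
      IsLUB (Set.range νQ) ν ∧
      (∀ Q : QQ, IsResidueTranscendental (νQ Q)) := by
  have hV : ¬ IsValueTranscendental ν := (not_or.1 hν).1
  have hK : IsKrull ν.1 := not_not.1 (not_or.1 hV).1
  obtain ⟨νbar, hext⟩ := exists_extendsToClosure hΓ ν.1 hK
  choose c hc using fun Q : {Q : K[X] | IsKeyFor νbar Q} => Q.2.exists_isCenter hK hext
  let νQ : {Q : K[X] | IsKeyFor νbar Q} → ExtVal ν₀ := fun Q => restrictGauss hext (c Q).1 (c Q).2
  have hmono : ∀ {Q R}, (c Q).2 ≤ (c R).2 → νQ Q ≤ νQ R := fun {Q R} h f =>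
    fstVal_lexGauss_mono (hc Q).2.1 (hc R).2.1 h (f.map (algebraMap K (AlgebraicClosure K)))
  have hle : ∀ Q, νQ Q ≤ ν := fun Q f =>
    (fstVal_lexGauss_le (hc Q).2.1 (f.map (algebraMap K (AlgebraicClosure K)))).trans_eq (hext f)
  have heq : ∀ (Q) (f : K[X]), f ≠ 0 →
      delta νbar (f.map (algebraMap K (AlgebraicClosure K))) ≤
        delta νbar (Q.1.map (algebraMap K (AlgebraicClosure K))) → (νQ Q).1 f = ν.1 f :=
    fun Q f hf h => restrictGauss_eq hext (hc Q).2.1 fun b hb _ => (hc Q).linear_le hf h hb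
  have hlt : ∀ Q, ∃ R, νQ Q < νQ R := by
    intro Q
    -- A strictly closer `b` gives a key polynomial `R` with larger `δ`. The two truncations differ
    -- at `R` itself, where that at `R` already equals `ν` and that at `Q` falls short.
    obtain ⟨b, hb⟩ := exists_linear_lt hν hext (c Q).1
    obtain ⟨R, hR, hbR⟩ := exists_isKeyFor νbar b
    have hγ : (c Q).2 < (c ⟨R, hR⟩).2 := by
      rw [(hc ⟨R, hR⟩).2.2, WithBot.coe_le_coe] at hbR
      have := hb.trans_le hbR
      rwa [(hc Q).2.1, WithTop.coe_lt_coe] at this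
    refine ⟨⟨R, hR⟩, lt_of_le_not_ge (hmono hγ.le) fun h => ?_⟩
    have h1 : (νQ Q).1 R < ν.1 R := by
      rw [← hext]
      exact fstVal_lexGauss_lt (linear_ne_top hK hext) (hc Q).2.1
        ((Polynomial.map_ne_zero_iff (algebraMap K (AlgebraicClosure K)).injective).2
          hR.1.ne_zero) (hc ⟨R, hR⟩).1 (by rwa [(hc ⟨R, hR⟩).2.1, WithTop.coe_lt_coe])
    rw [← heq ⟨R, hR⟩ R hR.1.ne_zero le_rfl] at h1
    exact (h R).not_gt h1
  -- Starting above an arbitrary `Q` lets the stable value from any stage be compared with `ν f`.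
  have hcofinal : ∀ (f : K[X]) (Q), ∃ R, νQ Q ≤ νQ R ∧
      ∀ S, νQ R ≤ νQ S → (νQ S).1 f = ν.1 f := by
    intro f Q
    suffices h : ∃ R, νQ Q ≤ νQ R ∧ (νQ R).1 f = ν.1 f by
      obtain ⟨R, h1, h2⟩ := h
      -- Once the value `ν f` is reached it persists, as every truncation is bounded by `ν`.
      exact ⟨R, h1, fun S hS => le_antisymm (hle S f) (h2 ▸ hS f)⟩
    by_cases hf : f = 0
    · exact ⟨Q, le_rfl, by rw [hf, AddValuation.map_zero, AddValuation.map_zero]⟩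
    obtain ⟨b, hb⟩ := exists_delta_le νbar (f.map (algebraMap K (AlgebraicClosure K)))
    obtain ⟨R, hR, hbR⟩ := exists_isKeyFor νbar b
    rcases le_total (c Q).2 (c ⟨R, hR⟩).2 with h | h
    · exact ⟨⟨R, hR⟩, hmono h, heq _ f hf (hb.trans hbR)⟩
    · refine ⟨Q, le_rfl, heq _ f hf ((hb.trans hbR).trans ?_)⟩
      rw [(hc Q).2.2, (hc ⟨R, hR⟩).2.2]
      exact WithBot.coe_le_coe.2 (WithTop.coe_le_coe.2 h)
  -- The family is nonempty, so `hcofinal` has a starting point.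
  obtain ⟨Q₀, hQ₀, -⟩ := exists_isKeyFor νbar 0
  refine ⟨{Q | IsKeyFor νbar Q}, νQ, fun Q => ⟨Q.2.1, Q.2.2.1, νbar, hext, Q.2.2.2⟩,
    fun Q f => (hc Q).restrictGauss_eq_truncation hext Q.2 hK f, ?_, ?_, fun f => ?_, ?_, ?_,
    fun Q => ?_⟩
  · rintro _ ⟨Q, rfl⟩ _ ⟨R, rfl⟩ -
    exact (le_total (c Q).2 (c R).2).imp hmono hmono
  · rintro _ ⟨⟨Q, rfl⟩, hmax⟩
    obtain ⟨R, h⟩ := hlt Q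
    exact h.not_ge (hmax ⟨R, rfl⟩ h.le)
  · obtain ⟨R, -, hR⟩ := hcofinal f ⟨Q₀, hQ₀⟩
    refine ⟨νQ R, ⟨R, rfl⟩, ?_⟩
    rintro _ ⟨S, rfl⟩ hS
    rw [hR S hS, hR R le_rfl]
  · rintro f _ ⟨⟨Q, rfl⟩, hst⟩
    obtain ⟨R, hQR, hR⟩ := hcofinal f Q
    rw [← hR R le_rfl, hst _ ⟨R, rfl⟩ hQR]
  · refine ⟨?_, fun η hη f => ?_⟩
    · rintro _ ⟨Q, rfl⟩
      exact hle Q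
    · obtain ⟨R, -, hR⟩ := hcofinal f ⟨Q₀, hQ₀⟩
      exact (hR R le_rfl).ge.trans (hη ⟨R, rfl⟩ f)
  · exact restrictGauss_isResidueTranscendental hV hext (hc Q).2.1 Q.2.1.ne_zero (hc Q).1
      fun b hb => (hc Q).linear_le Q.2.1.ne_zero le_rfl hb
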